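/- Let $R=\mathbb{C}[x_1,x_2,x_3,x_4]$ with the standard grading and with the symmetric group $\mathfrak{S}_4$ permuting the variables, and let $S^{(2,2)}$ denote the irreducible (Specht) representation of $\mathfrak{S}_4$ indexed by the partition $(2,2)$. Four homogeneous polynomials in $R$ form a regular sequence if their only common zero in $\mathbb{C}^4$ is the origin. A regular sequence of type $S^{(2,2)}\oplus S^{(4)}\oplus S^{(4)}$ with degree tuple $(a,a,c,d)$ is a regular sequence $g_1,g_2,f_1,f_2$ of homogeneous polynomials in $R$ such that $g_1,g_2$ have degree $a$ and form a basis of an $\mathfrak{S}_4$-stable subspace of $R$ isomorphic to $S^{(2,2)}$, and $f_1,f_2$ are symmetric polynomials of degrees $c$ and $d$. Let $c,d$ be positive integers. If $a=2$ or $a=4$, then a regular sequence of type $S^{(2,2)}\oplus S^{(4)}\oplus S^{(4)}$ with degree tuple $(a,a,c,d)$ exists if and only if $(c,d)\neq(1,1)$ (that is, if we order the degrees so that $c\le d$, if and only if $d\ge 2$). If $a=3$, then no such sequence exists. Moreover, whenever $g_1,g_2\in R$ are homogeneous of degree $3$ and form a basis of a subrepresentation isomorphic to $S^{(2,2)}$,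 they have a common factor of positive degree. -/

import Mathlib

/-! ### The action of the symmetric group on polynomials -/

/-- The action of `𝔖ₙ` on `ℂ[x₁, …, xₙ]` permuting the variables: `σ · xᵢ = x_{σ(i)}`. -/
noncomputable def permPolyRep (n : ℕ) :
    Representation ℂ (Equiv.Perm (Fin n)) (MvPolynomial (Fin n) ℂ) where
  toFun σ := (MvPolynomial.rename (R := ℂ) (σ : Fin n → Fin n)).toLinearMap
  map_one' := by
    apply LinearMap.ext
    intro p
    exact MvPolynomial.rename_id_apply p
  map_mul' σ τ := by
    apply LinearMap.ext
    intro p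
    exact (MvPolynomial.rename_rename (τ : Fin n → Fin n) (σ : Fin n → Fin n) p).symm

/-! ### Specht modules -/

namespace Specht

/-- A Young tableau of shape `μ` with entries `0, …, n-1`, each used exactly once, given by the
cell that each entry occupies. -/
abbrev Tableau (n : ℕ) (μ : YoungDiagram) : Type := Fin n ≃ {x : ℕ × ℕ // x ∈ μ.cells}

variable {n : ℕ} {μ : YoungDiagram}

/-- The tabloid of `t`, i.e. `t` up to reordering the entries inside each row: it is determined by
the function that sends an entry to the index of its row. -/
def tabloid (t : Tableau n μ) : Fin n → ℕ := fun i => (t i).1.1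

/-- The column group of `t`: the permutations of the entries that preserve each column. -/
def IsColumnPerm (t : Tableau n μ) (π : Equiv.Perm (Fin n)) : Prop :=
  ∀ i, (t (π i)).1.2 = (t i).1.2

instance (t : Tableau n μ) : DecidablePred (IsColumnPerm t) :=
  fun π => inferInstanceAs (Decidable (∀ i, (t (π i)).1.2 = (t i).1.2))

/-- The permutation representation of `𝔖ₙ` on formal `ℂ`-linear combinations of row functions
`Fin n → ℕ`. It contains, for each shape `μ`, the permutation module spanned by the tabloids of
shape `μ`. -/
noncomputable def tabloidRep (n : ℕ) :
    Representation ℂ (Equiv.Perm (Fin n)) ((Fin n → ℕ) →₀ ℂ) where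
  toFun σ := Finsupp.lmapDomain ℂ ℂ (fun r : Fin n → ℕ => r ∘ (σ⁻¹ : Equiv.Perm (Fin n)))
  map_one' := by
    apply LinearMap.ext
    intro v
    exact Finsupp.mapDomain_id
  map_mul' σ τ := by
    apply LinearMap.ext
    intro v
    simp only [Module.End.mul_apply, Finsupp.lmapDomain_apply, ← Finsupp.mapDomain_comp]
    congr 1

/-- The polytabloid `e_t = ∑_{π ∈ C_t} sgn(π) {π t}`. -/
noncomputable def polytabloid (t : Tableau n μ) : (Fin n → ℕ) →₀ ℂ :=
  ∑ π : Equiv.Perm (Fin n) with IsColumnPerm t π,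
    Finsupp.single (tabloid t ∘ (π⁻¹ : Equiv.Perm (Fin n))) ((Equiv.Perm.sign π : ℤ) : ℂ)

theorem tabloidRep_polytabloid (σ : Equiv.Perm (Fin n)) (t : Tableau n μ) :
    tabloidRep n σ (polytabloid t) = polytabloid ((σ⁻¹ : Equiv.Perm (Fin n)).trans t) := by
  change Finsupp.lmapDomain ℂ ℂ _ (polytabloid t) = _
  unfold polytabloid
  rw [map_sum]
  refine Finset.sum_bij' (fun π _ => σ * π * σ⁻¹) (fun π _ => σ⁻¹ * π * σ) ?_ ?_ ?_ ?_ ?_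
  · intro π hπ
    simp only [Finset.mem_filter, Finset.mem_univ, true_and] at hπ ⊢
    intro i
    simpa [Equiv.Perm.mul_apply] using hπ (σ⁻¹ i)
  · intro π hπ
    simp only [Finset.mem_filter, Finset.mem_univ, true_and] at hπ ⊢
    intro i
    simpa [Equiv.Perm.mul_apply] using hπ (σ i)
  · intro π _
    group
  · intro π _
    group
  · intro π _
    rw [Finsupp.lmapDomain_apply, Finsupp.mapDomain_single]
    congr 1
    · funext i
      simp [tabloid]
    · simp [mul_right_comm]

/-- The Specht module `S^μ`: the subrepresentation spanned by the polytabloids of shape `μ`. -/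
noncomputable def spechtSubrep (n : ℕ) (μ : YoungDiagram) : Subrepresentation (tabloidRep n) where
  toSubmodule := Submodule.span ℂ (Set.range (polytabloid (n := n) (μ := μ)))
  apply_mem_toSubmodule σ v hv := by
    induction hv using Submodule.span_induction with
    | mem x hx =>
      obtain ⟨t, rfl⟩ := hx
      rw [tabloidRep_polytabloid]
      exact Submodule.subset_span ⟨_, rfl⟩
    | zero => rw [map_zero]; exact Submodule.zero_mem _
    | add x y _ _ hx hy => rw [map_add]; exact Submodule.add_mem _ hx hy
    | smul a x _ hx => rw [map_smul]; exact Submodule.smul_mem _ a hx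

/-- The Young diagram of the partition `(2,2)`. -/
def shape22 : YoungDiagram :=
  YoungDiagram.ofRowLens [2, 2] (by simp [List.sortedGE_iff_pairwise])

end Specht

/-! ### Regular sequences -/

/-- Homogeneous polynomials `f₁, …, fₙ` in `ℂ[x₁, …, xₙ]` form a (maximal) regular sequence if
their only common zero is the origin. -/
def IsMaximalRegularSequence {n : ℕ} (f : Fin n → MvPolynomial (Fin n) ℂ) : Prop :=
  (∀ i, ∃ m : ℕ, (f i).IsHomogeneous m) ∧
    {x : Fin n → ℂ | ∀ i, MvPolynomial.eval x (f i) = 0} = {0}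

/-- `g₁, g₂` are homogeneous of degree `a` and form a basis of a subrepresentation of
`ℂ[x₁, …, x₄]` that is isomorphic to `S^(2,2)`. -/
structure IsBasisOfS22 (a : ℕ) (g₁ g₂ : MvPolynomial (Fin 4) ℂ) : Prop where
  homogeneous_fst : g₁.IsHomogeneous a
  homogeneous_snd : g₂.IsHomogeneous a
  linearIndependent : LinearIndependent ℂ ![g₁, g₂]
  isSpecht : ∃ V : Subrepresentation (permPolyRep 4),
    V.toSubmodule = Submodule.span ℂ {g₁, g₂} ∧
      Nonempty (V.toRepresentation.Equiv (Specht.spechtSubrep 4 Specht.shape22).toRepresentation)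

/-- `g₁, g₂, f₁, f₂` is a homogeneous regular sequence of type `S^(2,2) ⊕ S^(4) ⊕ S^(4)` with
degrees `(a, a, c, d)`: `g₁, g₂` form a basis of a copy of `S^(2,2)` in degree `a`, and `f₁, f₂`
are symmetric of degrees `c` and `d`. -/
structure IsRegularSequenceOfType (a c d : ℕ) (g₁ g₂ f₁ f₂ : MvPolynomial (Fin 4) ℂ) : Prop where
  basis : IsBasisOfS22 a g₁ g₂
  symmetric_fst : f₁.IsSymmetric
  symmetric_snd : f₂.IsSymmetric
  homogeneous_fst : f₁.IsHomogeneous c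
  homogeneous_snd : f₂.IsHomogeneous d
  regular : IsMaximalRegularSequence ![g₁, g₂, f₁, f₂]

/-! ### Polynomial algebra: zero sets, antisymmetry, homogeneous cofactors -/

namespace MvPolynomial

/-! A copy of S^(2,2) is generated by the image w of one polytabloid. The transpositions (0 2) and
(1 3) negate w, so w = (x₀-x₂)(x₁-x₃)h with h invariant under the double transpositions
(`exists_generator_eq_mul`). This form of w gives both obstructions. Every translate of w vanishes
at (1,1,1,-3), and so do all symmetric linear forms, which excludes c = d = 1. In degree 3, h is
linear and invariant under a transitive group, hence a multiple of p₁ = x₀+x₁+x₂+x₃; then p₁, f₁, f₂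
would cut out the origin in ℂ⁴, against Krull's height theorem (`zeros_ne_singleton_of_ncard_lt`).

For existence in degree 2k, k = 1, 2, attach to the three splittings of the variables into pairs
quadratic forms A, B, C with A+B+C = 0, permuted by 𝔖₄. The differences A^k-C^k and B^k-C^k span a
copy of S^(2,2) (`isBasisOfS22_formPowMap`). Their common zeros satisfy A = B = C = 0, which makes
three coordinates equal. A power of p₁ together with a power sum p_m, m ≥ 2, leaves only the origin.
-/

theorem exists_isMaximal_le_height (n : ℕ) :
    ∃ M : Ideal (MvPolynomial (Fin n) ℂ), M.IsMaximal ∧ (n : ℕ∞) ≤ M.height := by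
  have hdim : ringKrullDim (MvPolynomial (Fin n) ℂ) = n := by
    rw [ringKrullDim_of_isNoetherianRing]
    simp
  by_contra! h
  rcases n with _ | n
  · obtain ⟨M, hM⟩ := Ideal.exists_maximal (MvPolynomial (Fin 0) ℂ)
    exact not_lt_bot (h M hM)
  · have hle : ringKrullDim (MvPolynomial (Fin (n + 1)) ℂ) ≤ (n : WithBot ℕ∞) := by
      rw [ringKrullDim_le_iff_isMaximal_height_le]
      intro M hM
      have hlt := h M hM
      rw [Nat.cast_add, Nat.cast_one, ENat.lt_add_one_iff (ENat.natCast_ne_top n)] at hlt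
      exact_mod_cast hlt
    rw [hdim] at hle
    have : n + 1 ≤ n := by exact_mod_cast hle
    omega

/-- Fewer than `n` polynomials in `n` variables never have exactly one common zero. -/
theorem zeros_ne_singleton_of_ncard_lt {n : ℕ} {s : Set (MvPolynomial (Fin n) ℂ)}
    (hs : s.Finite) (hcard : s.ncard < n) (p : Fin n → ℂ) :
    {x : Fin n → ℂ | ∀ f ∈ s, eval x f = 0} ≠ {p} := by
  intro hp
  obtain ⟨M, hM, hheight⟩ := exists_isMaximal_le_height n
  obtain ⟨x, rfl⟩ := isMaximal_iff_eq_vanishingIdeal_singleton.mp hM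
  -- A large height is known only for the maximal ideal of the point `x`, so the common zero is
  -- translated from `p` to `x`.
  let τ : MvPolynomial (Fin n) ℂ →ₐ[ℂ] MvPolynomial (Fin n) ℂ :=
    aeval fun i => X i + C (p i - x i)
  have hτ (y : Fin n → ℂ) (f) : aeval y (τ f) = aeval (y + (p - x)) f := by
    induction f using MvPolynomial.induction_on with
    | C a => simp [τ]
    | add f g hf hg => rw [map_add, map_add, hf, hg, map_add]
    | mul_X f i hf => rw [map_mul, map_mul, hf, map_mul]; simp [τ]
  have hzero : zeroLocus ℂ (Ideal.span (τ '' s)) = {x} := by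
    rw [zeroLocus_span]
    ext y
    have hy : (∀ f ∈ s, aeval (y + (p - x)) f = 0) ↔ y + (p - x) = p :=
      Set.ext_iff.mp hp (y + (p - x))
    simp only [Set.mem_image, forall_exists_index, and_imp, forall_apply_eq_imp_iff₂,
      Set.mem_ofPred_eq, Set.mem_singleton_iff, hτ]
    refine hy.trans ⟨fun h => ?_, fun h => ?_⟩
    · linear_combination (exp := 1) h
    · rw [h]; abel
  have hrad : (Ideal.span (τ '' s)).radical = vanishingIdeal ℂ {x} := by
    rw [← vanishingIdeal_zeroLocus_eq_radical (K := ℂ), hzero]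
  -- By the Nullstellensatz the radical is this maximal ideal, so it is a minimal prime and its
  -- height is at most the number of generators.
  have hmin : vanishingIdeal ℂ {x} ∈ (Ideal.span (τ '' s)).minimalPrimes := by
    rw [← Ideal.radical_minimalPrimes, hrad, Ideal.minimalPrimes_eq_subsingleton_self]
    rfl
  have hle := Ideal.height_le_card_of_mem_minimalPrimes_span (hs.image τ) hmin
  have : n ≤ (τ '' s).ncard := by exact_mod_cast hheight.trans hle
  have := Set.ncard_image_le (f := τ) hs
  omega

/-- The difference p - s·p obeys a twisted Leibniz rule, which reduces the claim to single
variables. -/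
theorem X_sub_X_dvd_sub_rename_swap {σ : Type*} [DecidableEq σ] (i j : σ)
    (p : MvPolynomial σ ℂ) : X i - X j ∣ p - rename (Equiv.swap i j) p := by
  induction p using MvPolynomial.induction_on with
  | C a => simp
  | add p q hp hq =>
    rw [map_add, add_sub_add_comm]
    exact dvd_add hp hq
  | mul_X p k hp =>
    have hk : (X i - X j : MvPolynomial σ ℂ) ∣ X k - X (Equiv.swap i j k) := by
      rcases eq_or_ne k i with rfl | hki
      · simp
      rcases eq_or_ne k j with rfl | hkj
      · rw [Equiv.swap_apply_right]
        exact dvd_sub_comm.mp dvd_rfl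
      · simp [Equiv.swap_apply_of_ne_of_ne hki hkj]
    rw [map_mul, rename_X]
    have : p * X k - rename (Equiv.swap i j) p * X (Equiv.swap i j k) =
        (p - rename (Equiv.swap i j) p) * X k +
          rename (Equiv.swap i j) p * (X k - X (Equiv.swap i j k)) := by ring
    rw [this]
    exact dvd_add (hp.mul_right _) (hk.mul_left _)

theorem X_sub_X_dvd_of_rename_swap_eq_neg {σ : Type*} [DecidableEq σ] {i j : σ}
    {p : MvPolynomial σ ℂ} (hp : rename (Equiv.swap i j) p = -p) : X i - X j ∣ p := by
  have h := X_sub_X_dvd_sub_rename_swap i j p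
  rw [hp, sub_neg_eq_add, ← two_mul] at h
  have h2 : IsUnit (2 : MvPolynomial σ ℂ) := by
    have : (2 : MvPolynomial σ ℂ) = C 2 := (map_ofNat C 2).symm
    rw [this]
    exact (isUnit_iff_ne_zero.mpr two_ne_zero).map C
  exact (h2.dvd_mul_left).mp h

attribute [local instance] gradedAlgebra in
/-- A cofactor of a nonzero homogeneous factor of a homogeneous polynomial is homogeneous. -/
theorem IsHomogeneous.of_mul_right {σ : Type*} {p q : MvPolynomial σ ℂ} {m n : ℕ}
    (hp : p.IsHomogeneous m) (hp0 : p ≠ 0) (hpq : (p * q).IsHomogeneous (m + n)) :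
    q.IsHomogeneous n := by
  have h := DirectSum.coe_decompose_mul_add_of_left_mem (homogeneousSubmodule σ ℂ) (b := q)
    (j := n) (a := p) (i := m) hp
  rw [DirectSum.decompose_of_mem_same _ hpq] at h
  rw [mul_left_cancel₀ hp0 h]
  exact (DirectSum.decompose (homogeneousSubmodule σ ℂ) q n).2

end MvPolynomial

/-! ### The polytabloids of shape (2,2) -/

namespace Specht

variable {n : ℕ}

theorem mem_shape22 (x : ℕ × ℕ) : x ∈ shape22.cells ↔ x.1 < 2 ∧ x.2 < 2 := by
  rw [YoungDiagram.mem_cells, shape22, YoungDiagram.mem_ofRowLens]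
  constructor
  · rintro ⟨h1, h2⟩
    obtain ⟨i, j⟩ := x
    simp only [List.length_cons, List.length_nil] at h1
    interval_cases i <;> simp_all
  · rintro ⟨h1, h2⟩
    obtain ⟨i, j⟩ := x
    simp only at h1 h2
    interval_cases i <;> simp_all

/-- The tableau with rows `0 1` and `2 3`. -/
def tableau22 : Tableau 4 shape22 where
  toFun i := ⟨(i / 2, i % 2), (mem_shape22 _).mpr ⟨by simp only; omega, by simp only; omega⟩⟩
  invFun x := ⟨2 * x.1.1 + x.1.2, by have := (mem_shape22 _).mp x.2; omega⟩
  left_inv i := by ext; simp only; omega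
  right_inv x := by
    have := (mem_shape22 _).mp x.2
    ext <;> simp only <;> omega

theorem isColumnPerm_tableau22 (π : Equiv.Perm (Fin 4)) :
    IsColumnPerm tableau22 π ↔ ∀ i, (π i : ℕ) % 2 = (i : ℕ) % 2 := Iff.rfl

/-- The polytabloid of the tableau with rows `0 1` and `2 3`. -/
theorem polytabloid_tableau22 : polytabloid tableau22 =
    Finsupp.single ![0, 0, 1, 1] 1 - Finsupp.single ![1, 0, 0, 1] 1 -
      Finsupp.single ![0, 1, 1, 0] 1 + Finsupp.single ![1, 1, 0, 0] 1 := by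
  have hfilter : ({π : Equiv.Perm (Fin 4) | IsColumnPerm tableau22 π} : Finset _) =
      {1, Equiv.swap 0 2, Equiv.swap 1 3, Equiv.swap 0 2 * Equiv.swap 1 3} := by
    simp only [isColumnPerm_tableau22]
    decide
  have htab : tabloid tableau22 = ![0, 0, 1, 1] := by
    funext i
    fin_cases i <;> rfl
  rw [polytabloid, hfilter, htab, Finset.sum_insert (by decide), Finset.sum_insert (by decide),
    Finset.sum_insert (by decide), Finset.sum_singleton]
  have h1 : (![0, 0, 1, 1] : Fin 4 → ℕ) ∘ (1⁻¹ : Equiv.Perm (Fin 4)) = ![0, 0, 1, 1] := by decide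
  have h2 : (![0, 0, 1, 1] : Fin 4 → ℕ) ∘ ((Equiv.swap 0 2)⁻¹ : Equiv.Perm (Fin 4)) =
    ![1, 0, 0, 1] := by decide
  have h3 : (![0, 0, 1, 1] : Fin 4 → ℕ) ∘ ((Equiv.swap 1 3)⁻¹ : Equiv.Perm (Fin 4)) =
    ![0, 1, 1, 0] := by decide
  have h4 : (![0, 0, 1, 1] : Fin 4 → ℕ) ∘
      ((Equiv.swap 0 2 * Equiv.swap 1 3)⁻¹ : Equiv.Perm (Fin 4)) = ![1, 1, 0, 0] := by decide
  rw [h1, h2, h3, h4, Equiv.Perm.sign_mul, Equiv.Perm.sign_swap (by decide),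
    Equiv.Perm.sign_swap (by decide), Equiv.Perm.sign_one]
  simp only [Units.val_one, Int.cast_one, Units.val_neg, Int.cast_neg, neg_mul_neg, mul_one,
    Finsupp.single_neg]
  abel

theorem tabloidRep_single (σ : Equiv.Perm (Fin n)) (r : Fin n → ℕ) (a : ℂ) :
    tabloidRep n σ (Finsupp.single r a) = Finsupp.single (r ∘ (σ⁻¹ : Equiv.Perm (Fin n))) a :=
  Finsupp.mapDomain_single

/-- Tableaux of a given shape form one orbit, so any single polytabloid generates the Specht module.
-/
theorem polytabloid_eq_tabloidRep {μ : YoungDiagram} (t s : Tableau n μ) :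
    polytabloid t = tabloidRep n (t.trans s.symm)⁻¹ (polytabloid s) := by
  rw [tabloidRep_polytabloid, inv_inv]
  congr 1
  ext i : 1
  simp

end Specht

namespace Specht

theorem tabloidRep_swap_zero_two_polytabloid :
    tabloidRep 4 (Equiv.swap 0 2) (polytabloid tableau22) = -polytabloid tableau22 := by
  rw [polytabloid_tableau22]
  simp only [map_add, map_sub, tabloidRep_single]
  rw [show (![0, 0, 1, 1] : Fin 4 → ℕ) ∘ ⇑(Equiv.swap 0 2)⁻¹ = ![1, 0, 0, 1] by decide,
    show (![1, 0, 0, 1] : Fin 4 → ℕ) ∘ ⇑(Equiv.swap 0 2)⁻¹ = ![0, 0, 1, 1] by decide,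
    show (![0, 1, 1, 0] : Fin 4 → ℕ) ∘ ⇑(Equiv.swap 0 2)⁻¹ = ![1, 1, 0, 0] by decide,
    show (![1, 1, 0, 0] : Fin 4 → ℕ) ∘ ⇑(Equiv.swap 0 2)⁻¹ = ![0, 1, 1, 0] by decide]
  abel

theorem tabloidRep_swap_one_three_polytabloid :
    tabloidRep 4 (Equiv.swap 1 3) (polytabloid tableau22) = -polytabloid tableau22 := by
  rw [polytabloid_tableau22]
  simp only [map_add, map_sub, tabloidRep_single]
  rw [show (![0, 0, 1, 1] : Fin 4 → ℕ) ∘ ⇑(Equiv.swap 1 3)⁻¹ = ![0, 1, 1, 0] by decide,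
    show (![1, 0, 0, 1] : Fin 4 → ℕ) ∘ ⇑(Equiv.swap 1 3)⁻¹ = ![1, 1, 0, 0] by decide,
    show (![0, 1, 1, 0] : Fin 4 → ℕ) ∘ ⇑(Equiv.swap 1 3)⁻¹ = ![0, 0, 1, 1] by decide,
    show (![1, 1, 0, 0] : Fin 4 → ℕ) ∘ ⇑(Equiv.swap 1 3)⁻¹ = ![1, 0, 0, 1] by decide]
  abel

/-- This permutation preserves both rows of the tableau and exchanges its two columns. -/
theorem tabloidRep_swap_mul_swap_polytabloid :
    tabloidRep 4 (Equiv.swap 0 1 * Equiv.swap 2 3) (polytabloid tableau22) =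
      polytabloid tableau22 := by
  rw [polytabloid_tableau22]
  simp only [map_add, map_sub, tabloidRep_single]
  rw [show (![0, 0, 1, 1] : Fin 4 → ℕ) ∘
        ⇑(Equiv.swap 0 1 * Equiv.swap 2 3 : Equiv.Perm (Fin 4))⁻¹ =
      ![0, 0, 1, 1] by decide,
    show (![1, 0, 0, 1] : Fin 4 → ℕ) ∘
        ⇑(Equiv.swap 0 1 * Equiv.swap 2 3 : Equiv.Perm (Fin 4))⁻¹ =
      ![0, 1, 1, 0] by decide,
    show (![0, 1, 1, 0] : Fin 4 → ℕ) ∘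
        ⇑(Equiv.swap 0 1 * Equiv.swap 2 3 : Equiv.Perm (Fin 4))⁻¹ =
      ![1, 0, 0, 1] by decide,
    show (![1, 1, 0, 0] : Fin 4 → ℕ) ∘
        ⇑(Equiv.swap 0 1 * Equiv.swap 2 3 : Equiv.Perm (Fin 4))⁻¹ =
      ![1, 1, 0, 0] by decide]
  abel

end Specht

/-! ### Structure of an arbitrary copy of S^(2,2) -/

open MvPolynomial Specht

namespace IsBasisOfS22

variable {a : ℕ} {g₁ g₂ : MvPolynomial (Fin 4) ℂ}

/-- A copy of `S^(2,2)` is generated by the image of a polytabloid. -/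
theorem exists_generator (hg : IsBasisOfS22 a g₁ g₂) :
    ∃ w ∈ Submodule.span ℂ {g₁, g₂},
      rename (Equiv.swap 0 2) w = -w ∧ rename (Equiv.swap 1 3) w = -w ∧
      rename (Equiv.swap 0 1 * Equiv.swap 2 3 : Equiv.Perm (Fin 4)) w = w ∧
      ∀ v ∈ Submodule.span ℂ {g₁, g₂},
        v ∈ Submodule.span ℂ (Set.range fun σ : Equiv.Perm (Fin 4) => rename σ w) := by
  obtain ⟨V, hV, ⟨E⟩⟩ := hg.isSpecht
  rw [← hV]
  let ψ : (spechtSubrep 4 shape22).toSubmodule →ₗ[ℂ] MvPolynomial (Fin 4) ℂ :=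
    V.toSubmodule.subtype ∘ₗ E.symm.toLinearEquiv.toLinearMap
  have hψ (σ : Equiv.Perm (Fin 4)) (s : (spechtSubrep 4 shape22).toSubmodule) :
      rename σ (ψ s) = ψ ((spechtSubrep 4 shape22).toRepresentation σ s) :=
    (congrArg Subtype.val (LinearMap.congr_fun (E.symm.isIntertwining' σ) s)).symm
  let e : (spechtSubrep 4 shape22).toSubmodule :=
    ⟨polytabloid tableau22, Submodule.subset_span ⟨_, rfl⟩⟩
  refine ⟨ψ e, (E.symm.toLinearEquiv e).2, ?_, ?_, ?_, fun v hv => ?_⟩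
  · rw [hψ, ← map_neg]
    exact congrArg ψ (Subtype.ext tabloidRep_swap_zero_two_polytabloid)
  · rw [hψ, ← map_neg]
    exact congrArg ψ (Subtype.ext tabloidRep_swap_one_three_polytabloid)
  · rw [hψ]
    exact congrArg ψ (Subtype.ext tabloidRep_swap_mul_swap_polytabloid)
  -- Each polytabloid is a translate of `e`, so equivariance puts the whole image of `ψ` in the span
  -- of the translates of `ψ e`.
  · have key (s) (hs : s ∈ (spechtSubrep 4 shape22).toSubmodule) : ψ ⟨s, hs⟩ ∈
        Submodule.span ℂ (Set.range fun σ : Equiv.Perm (Fin 4) => rename σ (ψ e)) := by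
      induction hs using Submodule.span_induction with
      | mem x hx =>
        obtain ⟨t, rfl⟩ := hx
        refine Submodule.subset_span ⟨(t.trans tableau22.symm)⁻¹, ?_⟩
        change rename ((t.trans tableau22.symm)⁻¹ : Equiv.Perm (Fin 4)) (ψ e) = _
        rw [hψ]
        exact congrArg ψ (Subtype.ext (polytabloid_eq_tabloidRep t tableau22).symm)
      | zero =>
        rw [show (⟨0, _⟩ : (spechtSubrep 4 shape22).toSubmodule) = 0 from rfl, map_zero]
        exact Submodule.zero_mem _
      | add x y hx hy ihx ihy =>
        exact (map_add ψ ⟨x, hx⟩ ⟨y, hy⟩) ▸ Submodule.add_mem _ ihx ihy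
      | smul c x hx ihx =>
        exact (map_smul ψ c ⟨x, hx⟩) ▸ Submodule.smul_mem _ c ihx
    have h := key _ (E.toLinearEquiv ⟨v, hv⟩).2
    have : ψ (E.toLinearEquiv ⟨v, hv⟩) = v :=
      congrArg Subtype.val (E.toLinearEquiv.symm_apply_apply ⟨v, hv⟩)
    rwa [Subtype.coe_eta, this] at h

/-- A generator of a copy of `S^(2,2)` has the factor `(X₀ - X₂)(X₁ - X₃)`. -/
theorem exists_generator_eq_mul (hg : IsBasisOfS22 a g₁ g₂) :
    ∃ h : MvPolynomial (Fin 4) ℂ,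
      ((X 0 - X 2) * (X 1 - X 3)) * h ∈ Submodule.span ℂ {g₁, g₂} ∧
      rename (Equiv.swap 0 2 * Equiv.swap 1 3 : Equiv.Perm (Fin 4)) h = h ∧
      rename (Equiv.swap 0 1 * Equiv.swap 2 3 : Equiv.Perm (Fin 4)) h = h ∧
      ∀ v ∈ Submodule.span ℂ {g₁, g₂}, v ∈ Submodule.span ℂ
        (Set.range fun σ : Equiv.Perm (Fin 4) =>
          rename σ (((X 0 - X 2) * (X 1 - X 3)) * h)) := by
  obtain ⟨w, hw, h02, h13, hV, hspan⟩ := hg.exists_generator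
  have hX {i j : Fin 4} (hij : i ≠ j) : (X i - X j : MvPolynomial (Fin 4) ℂ) ≠ 0 :=
    sub_ne_zero.mpr fun h => hij (X_injective h)
  obtain ⟨k, rfl⟩ := X_sub_X_dvd_of_rename_swap_eq_neg h02
  -- The transposition (1 3) fixes X₀ - X₂, so the sign passes to the cofactor.
  have hk : rename (Equiv.swap 1 3) k = -k := by
    refine mul_left_cancel₀ (hX (show (0 : Fin 4) ≠ 2 by decide)) ?_
    rw [map_mul, map_sub, rename_X, rename_X,
      show Equiv.swap (1 : Fin 4) 3 0 = 0 by decide,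
      show Equiv.swap (1 : Fin 4) 3 2 = 2 by decide] at h13
    rw [h13, mul_neg]
  obtain ⟨h, rfl⟩ := X_sub_X_dvd_of_rename_swap_eq_neg hk
  have hδ : ((X 0 - X 2) * (X 1 - X 3) : MvPolynomial (Fin 4) ℂ) ≠ 0 :=
    mul_ne_zero (hX (by decide)) (hX (by decide))
  rw [← mul_assoc] at hw hspan hV h02 h13
  have h0213 : rename (Equiv.swap 0 2 * Equiv.swap 1 3 : Equiv.Perm (Fin 4))
      ((X 0 - X 2) * (X 1 - X 3) * h) = (X 0 - X 2) * (X 1 - X 3) * h := by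
    rw [Equiv.Perm.coe_mul, ← rename_rename, h13, map_neg, h02, neg_neg]
  refine ⟨h, hw, ?_, ?_, hspan⟩
  -- Both factors change sign under (0 2)(1 3), whereas (0 1)(2 3) exchanges them; either way their
  -- product is fixed and can be cancelled.
  · refine mul_left_cancel₀ hδ ?_
    simp only [map_mul, map_sub, rename_X] at h0213
    rw [show (Equiv.swap 0 2 * Equiv.swap 1 3 : Equiv.Perm (Fin 4)) 0 = 2 by decide,
      show (Equiv.swap 0 2 * Equiv.swap 1 3 : Equiv.Perm (Fin 4)) 1 = 3 by decide,
      show (Equiv.swap 0 2 * Equiv.swap 1 3 : Equiv.Perm (Fin 4)) 2 = 0 by decide,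
      show (Equiv.swap 0 2 * Equiv.swap 1 3 : Equiv.Perm (Fin 4)) 3 = 1 by decide] at h0213
    linear_combination h0213
  · refine mul_left_cancel₀ hδ ?_
    simp only [map_mul, map_sub, rename_X] at hV
    rw [show (Equiv.swap 0 1 * Equiv.swap 2 3 : Equiv.Perm (Fin 4)) 0 = 1 by decide,
      show (Equiv.swap 0 1 * Equiv.swap 2 3 : Equiv.Perm (Fin 4)) 1 = 0 by decide,
      show (Equiv.swap 0 1 * Equiv.swap 2 3 : Equiv.Perm (Fin 4)) 2 = 3 by decide,
      show (Equiv.swap 0 1 * Equiv.swap 2 3 : Equiv.Perm (Fin 4)) 3 = 2 by decide] at hV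
    linear_combination hV

/-- Every copy of `S^(2,2)` vanishes at the points with stabilizer `𝔖₃`. -/
theorem eval_eq_zero (hg : IsBasisOfS22 a g₁ g₂) (s t : ℂ) {v : MvPolynomial (Fin 4) ℂ}
    (hv : v ∈ Submodule.span ℂ {g₁, g₂}) : eval ![s, s, s, t] v = 0 := by
  obtain ⟨h, -, -, -, hspan⟩ := hg.exists_generator_eq_mul
  replace hspan := hspan v hv
  clear hv
  induction hspan using Submodule.span_induction with
  | mem x hx =>
    obtain ⟨σ, rfl⟩ := hx
    have hx (i : Fin 4) (hi : i ≠ 3) : (![s, s, s, t] : Fin 4 → ℂ) i = s := by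
      fin_cases i <;> simp_all
    -- The index 3 lies in only one of the disjoint pairs {σ 0, σ 2}, {σ 1, σ 3}; the other pair
    -- gives a vanishing factor.
    have hσ : (σ 0 ≠ 3 ∧ σ 2 ≠ 3) ∨ (σ 1 ≠ 3 ∧ σ 3 ≠ 3) := by
      by_contra! hcon
      have h01 : σ 0 ≠ σ 1 := σ.injective.ne (by decide)
      have h03 : σ 0 ≠ σ 3 := σ.injective.ne (by decide)
      have h21 : σ 2 ≠ σ 1 := σ.injective.ne (by decide)
      have h23 : σ 2 ≠ σ 3 := σ.injective.ne (by decide)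
      grind
    simp only [eval_rename, map_mul, map_sub, eval_X, Function.comp_apply]
    rcases hσ with ⟨h0, h2⟩ | ⟨h1, h3⟩
    · rw [hx _ h0, hx _ h2, sub_self, zero_mul, zero_mul]
    · rw [hx _ h1, hx _ h3, sub_self, mul_zero, zero_mul]
  | zero => exact map_zero _
  | add x y _ _ hx hy => rw [map_add, hx, hy, add_zero]
  | smul c x _ hx => rw [smul_eval, hx, mul_zero]

/-- The cofactor `h` is linear, and invariance under the transitive Klein four-group makes its
coefficients equal. Being symmetric, p₁ then divides every translate of the generator. -/
theorem psum_dvd_of_degree_three (hg : IsBasisOfS22 3 g₁ g₂) {v : MvPolynomial (Fin 4) ℂ}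
    (hv : v ∈ Submodule.span ℂ {g₁, g₂}) : psum (Fin 4) ℂ 1 ∣ v := by
  obtain ⟨h, hw, h0213, h0123, hspan⟩ := hg.exists_generator_eq_mul
  have hX (i j : Fin 4) : (X i - X j : MvPolynomial (Fin 4) ℂ).IsHomogeneous 1 :=
    (isHomogeneous_X _ _).sub (isHomogeneous_X _ _)
  have hX0 {i j : Fin 4} (hij : i ≠ j) : (X i - X j : MvPolynomial (Fin 4) ℂ) ≠ 0 :=
    sub_ne_zero.mpr fun h => hij (X_injective h)
  have hw3 : ((X 0 - X 2) * (X 1 - X 3) * h).IsHomogeneous (2 + 1) := by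
    have hle : Submodule.span ℂ {g₁, g₂} ≤ homogeneousSubmodule (Fin 4) ℂ 3 := by
      rw [Submodule.span_le]
      rintro x (rfl | rfl)
      · exact hg.homogeneous_fst
      · exact hg.homogeneous_snd
    exact hle hw
  have hh : h.IsHomogeneous 1 :=
    IsHomogeneous.of_mul_right ((hX 0 2).mul (hX 1 3))
      (mul_ne_zero (hX0 (by decide)) (hX0 (by decide))) hw3
  rw [← mem_homogeneousSubmodule, homogeneousSubmodule_one_eq_span_X,
    Submodule.mem_span_range_iff_exists_fun] at hh
  obtain ⟨c, rfl⟩ := hh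
  have hc (σ : Equiv.Perm (Fin 4))
      (hσ : rename σ (∑ i, c i • X i : MvPolynomial (Fin 4) ℂ) = ∑ i, c i • X i) (i : Fin 4) :
      c i = c (σ i) := by
    -- Evaluation at a standard basis vector reads off one coefficient.
    have := congrArg (eval (Pi.single (σ i) 1)) hσ
    simpa [eval_rename, smul_eval, Pi.single_apply] using this
  have e1 := hc _ h0213 0
  have e2 := hc _ h0123 0
  have e3 := hc _ h0123 2
  rw [show (Equiv.swap 0 2 * Equiv.swap 1 3 : Equiv.Perm (Fin 4)) 0 = 2 by decide] at e1
  rw [show (Equiv.swap 0 1 * Equiv.swap 2 3 : Equiv.Perm (Fin 4)) 0 = 1 by decide] at e2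
  rw [show (Equiv.swap 0 1 * Equiv.swap 2 3 : Equiv.Perm (Fin 4)) 2 = 3 by decide] at e3
  have hsum : (∑ i, c i • X i : MvPolynomial (Fin 4) ℂ) = psum (Fin 4) ℂ 1 * C (c 0) := by
    rw [psum_one, mul_comm, ← smul_eq_C_mul, Finset.smul_sum]
    simp only [Fin.sum_univ_four, ← e3, ← e1, ← e2]
  rw [hsum] at hspan
  replace hspan := hspan v hv
  clear hv
  induction hspan using Submodule.span_induction with
  | mem x hx =>
    obtain ⟨σ, rfl⟩ := hx
    simp only [map_mul, rename_psum]
    exact (dvd_mul_right _ _).mul_left _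
  | zero => exact dvd_zero _
  | add x y _ _ hx hy => exact dvd_add hx hy
  | smul c x _ hx => exact smul_eq_C_mul x c ▸ Dvd.dvd.mul_left hx (C c)

end IsBasisOfS22

/-! ### Obstructions to existence -/

theorem MvPolynomial.IsHomogeneous.eval_zero_of_pos {σ : Type*} {p : MvPolynomial σ ℂ} {m : ℕ}
    (hp : p.IsHomogeneous m) (hm : 0 < m) : eval 0 p = 0 := by
  rw [eval_zero, constantCoeff_eq]
  exact hp.coeff_eq_zero (by simpa using hm.ne)

theorem not_isRegularSequenceOfType_one_one {a : ℕ} {g₁ g₂ f₁ f₂ : MvPolynomial (Fin 4) ℂ} :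
    ¬ IsRegularSequenceOfType a 1 1 g₁ g₂ f₁ f₂ := by
  intro h
  have hlin {f : MvPolynomial (Fin 4) ℂ} (hf : f.IsHomogeneous 1) (hs : f.IsSymmetric) :
      eval ![1, 1, 1, -3] f = 0 := by
    rw [← mem_homogeneousSubmodule, homogeneousSubmodule_one_eq_span_X,
      Submodule.mem_span_range_iff_exists_fun] at hf
    obtain ⟨c, rfl⟩ := hf
    have hc (i : Fin 4) : c 3 = c i := by
      have := congrArg (eval (Pi.single i 1)) (hs (Equiv.swap 3 i))
      rw [eval_rename] at this
      simp only [map_sum, smul_eval, eval_X, Function.comp_apply, Pi.single_apply,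
        mul_ite, mul_one, mul_zero, Finset.sum_ite_eq', Finset.mem_univ, if_true] at this
      rw [Finset.sum_eq_single 3 (fun b _ hb => if_neg fun hbi => hb ?_) (by simp)] at this
      · simpa using this
      · rw [← Equiv.swap_apply_left 3 i] at hbi
        exact (Equiv.swap 3 i).injective hbi
    simp only [Fin.sum_univ_four, ← hc]
    simp
    ring
  have hmem : (![1, 1, 1, -3] : Fin 4 → ℂ) ∈
      {x : Fin 4 → ℂ | ∀ i, eval x (![g₁, g₂, f₁, f₂] i) = 0} := by
    intro i
    fin_cases i
    · exact h.basis.eval_eq_zero _ _ (Submodule.subset_span (by simp))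
    · exact h.basis.eval_eq_zero _ _ (Submodule.subset_span (by simp))
    · exact hlin h.homogeneous_fst h.symmetric_fst
    · exact hlin h.homogeneous_snd h.symmetric_snd
  rw [h.regular.2] at hmem
  simpa using congrFun hmem 0

/-- Since p₁ divides g₁ and g₂, the common zeros of p₁, f₁, f₂ are zeros of the whole sequence, and
three polynomials cannot isolate a point of ℂ⁴. -/
theorem not_isRegularSequenceOfType_three {c d : ℕ} (hc : 0 < c) (hd : 0 < d)
    {g₁ g₂ f₁ f₂ : MvPolynomial (Fin 4) ℂ} :
    ¬ IsRegularSequenceOfType 3 c d g₁ g₂ f₁ f₂ := by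
  intro h
  have hcard : ({psum (Fin 4) ℂ 1, f₁, f₂} : Set _).ncard < 4 := by
    have := Set.ncard_insert_le (psum (Fin 4) ℂ 1) {f₁, f₂}
    have := Set.ncard_insert_le f₁ {f₂}
    have := Set.ncard_singleton f₂
    omega
  refine zeros_ne_singleton_of_ncard_lt (Set.toFinite {psum (Fin 4) ℂ 1, f₁, f₂}) hcard 0 ?_
  refine Set.Subset.antisymm (fun x hx => ?_) ?_
  · rw [← h.regular.2]
    have h1 : eval x (psum (Fin 4) ℂ 1) = 0 := hx _ (by simp)
    have hzero {v : MvPolynomial (Fin 4) ℂ} (hv : v ∈ ({g₁, g₂} : Set _)) : eval x v = 0 := by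
      obtain ⟨q, rfl⟩ := h.basis.psum_dvd_of_degree_three (Submodule.subset_span hv)
      rw [map_mul, h1, zero_mul]
    intro i
    fin_cases i
    · exact hzero (by simp)
    · exact hzero (by simp)
    · exact hx f₁ (by simp)
    · exact hx f₂ (by simp)
  · rintro _ rfl f (rfl | rfl | rfl)
    · simp [psum]
    · exact h.homogeneous_fst.eval_zero_of_pos hc
    · exact h.homogeneous_snd.eval_zero_of_pos hd

/-! ### Copies of S^(2,2) in degrees 2 and 4 -/

/-- An intertwining map that is injective on a subrepresentation maps it isomorphically. -/
theorem Subrepresentation.exists_equiv_map {G W W' : Type*} [Group G] [AddCommGroup W]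
    [AddCommGroup W'] [Module ℂ W] [Module ℂ W'] {ρ : Representation ℂ G W}
    {τ : Representation ℂ G W'} (S : Subrepresentation ρ) (Φ : W →ₗ[ℂ] W')
    (hΦ : ∀ g v, Φ (ρ g v) = τ g (Φ v)) (hinj : ∀ v ∈ S.toSubmodule, Φ v = 0 → v = 0) :
    ∃ V : Subrepresentation τ, V.toSubmodule = S.toSubmodule.map Φ ∧
      Nonempty (V.toRepresentation.Equiv S.toRepresentation) := by
  let F : S.toSubmodule →ₗ[ℂ] S.toSubmodule.map Φ :=
    Φ.restrict fun v hv => Submodule.mem_map_of_mem hv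
  have hF : Function.Bijective F := by
    refine ⟨fun u v huv => ?_, ?_⟩
    · have h : Φ u = Φ v := congrArg Subtype.val huv
      refine Subtype.ext (sub_eq_zero.mp (hinj _ (S.toSubmodule.sub_mem u.2 v.2) ?_))
      rw [map_sub, h, sub_self]
    · rintro ⟨_, v, hv, rfl⟩
      exact ⟨⟨v, hv⟩, rfl⟩
  let V : Subrepresentation τ :=
    { toSubmodule := S.toSubmodule.map Φ
      apply_mem_toSubmodule := by
        rintro g _ ⟨v, hv, rfl⟩
        exact ⟨_, S.apply_mem_toSubmodule g hv, hΦ g v⟩ }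
  exact ⟨V, rfl, ⟨(Representation.Equiv.mk (ρ := S.toRepresentation) (σ := V.toRepresentation)
    (LinearEquiv.ofBijective F hF) fun g => LinearMap.ext fun v => Subtype.ext (hΦ g v.1)).symm⟩⟩

namespace Specht

variable {n : ℕ}

/-- The polytabloid is a difference of two of the three vectors attached to the splittings of four
entries into pairs. 𝔖₄ permutes these vectors, and the two spanning elements generate all their
differences. -/
theorem tabloidRep_polytabloid_tableau22_mem_span (σ : Equiv.Perm (Fin 4)) :
    tabloidRep 4 σ (polytabloid tableau22) ∈ Submodule.span ℂ
      {polytabloid tableau22, tabloidRep 4 (Equiv.swap 1 2) (polytabloid tableau22)} := by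
  -- For `r` with values 0 and 1, `1 - r i` exchanges the two rows, so `p r` depends only on the
  -- unordered splitting.
  let p (r : Fin 4 → ℕ) : (Fin 4 → ℕ) →₀ ℂ :=
    Finsupp.single r 1 + Finsupp.single (fun i => 1 - r i) 1
  have hp (τ : Equiv.Perm (Fin 4)) (r : Fin 4 → ℕ) :
      tabloidRep 4 τ (p r) = p (r ∘ (τ⁻¹ : Equiv.Perm (Fin 4))) := by
    simp only [p, map_add, tabloidRep_single]
    rfl
  have hpc (r s : Fin 4 → ℕ) (hr : ∀ i, 1 - (1 - r i) = r i) (h : (fun i => 1 - r i) = s) :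
      p s = p r := by
    subst h
    simp only [p, hr]
    exact add_comm _ _
  have he : polytabloid tableau22 = p ![0, 0, 1, 1] - p ![0, 1, 1, 0] := by
    simp only [p]
    rw [polytabloid_tableau22,
      show (fun i => 1 - (![0, 0, 1, 1] : Fin 4 → ℕ) i) = ![1, 1, 0, 0] by decide,
      show (fun i => 1 - (![0, 1, 1, 0] : Fin 4 → ℕ) i) = ![1, 0, 0, 1] by decide]
    abel
  have hmem (r : Fin 4 → ℕ) (hr : r = ![0, 0, 1, 1] ∨ r = ![0, 1, 1, 0])
      (τ : Equiv.Perm (Fin 4)) : tabloidRep 4 τ (p r) = p ![0, 0, 1, 1] ∨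
        tabloidRep 4 τ (p r) = p ![0, 1, 0, 1] ∨ tabloidRep 4 τ (p r) = p ![0, 1, 1, 0] := by
    have key : ∀ π : Equiv.Perm (Fin 4), (r ∘ π = ![0, 0, 1, 1] ∨ r ∘ π = ![1, 1, 0, 0]) ∨
        (r ∘ π = ![0, 1, 0, 1] ∨ r ∘ π = ![1, 0, 1, 0]) ∨
        (r ∘ π = ![0, 1, 1, 0] ∨ r ∘ π = ![1, 0, 0, 1]) := by
      rcases hr with rfl | rfl <;> decide
    rw [hp]
    refine (key τ⁻¹).imp ?_ (Or.imp ?_ ?_)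
    · rintro (h | h) <;> rw [h]
      exact hpc _ _ (by decide) (by decide)
    · rintro (h | h) <;> rw [h]
      exact hpc _ _ (by decide) (by decide)
    · rintro (h | h) <;> rw [h]
      exact hpc _ _ (by decide) (by decide)
  have he' : tabloidRep 4 (Equiv.swap 1 2) (polytabloid tableau22) =
      p ![0, 1, 0, 1] - p ![0, 1, 1, 0] := by
    rw [he, map_sub, hp, hp,
      show (![0, 0, 1, 1] : Fin 4 → ℕ) ∘ ⇑(Equiv.swap 1 2)⁻¹ = ![0, 1, 0, 1] by decide,
      show (![0, 1, 1, 0] : Fin 4 → ℕ) ∘ ⇑(Equiv.swap 1 2)⁻¹ = ![0, 1, 1, 0] by decide]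
  rw [he', he, map_sub, Submodule.mem_span_pair]
  rcases hmem _ (Or.inl rfl) σ with h1 | h1 | h1 <;>
    rcases hmem _ (Or.inr rfl) σ with h2 | h2 | h2 <;> rw [h1, h2]
  · exact ⟨0, 0, by module⟩
  · exact ⟨1, -1, by module⟩
  · exact ⟨1, 0, by module⟩
  · exact ⟨-1, 1, by module⟩
  · exact ⟨0, 0, by module⟩
  · exact ⟨0, 1, by module⟩
  · exact ⟨-1, 0, by module⟩
  · exact ⟨0, -1, by module⟩
  · exact ⟨0, 0, by module⟩

theorem spechtSubrep_shape22_eq_span : (spechtSubrep 4 shape22).toSubmodule = Submodule.span ℂ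
    {polytabloid tableau22, tabloidRep 4 (Equiv.swap 1 2) (polytabloid tableau22)} := by
  have hmem : polytabloid tableau22 ∈ (spechtSubrep 4 shape22).toSubmodule :=
    Submodule.subset_span ⟨_, rfl⟩
  refine le_antisymm (Submodule.span_le.mpr ?_) (Submodule.span_le.mpr ?_)
  · rintro _ ⟨t, rfl⟩
    rw [polytabloid_eq_tabloidRep t tableau22]
    exact tabloidRep_polytabloid_tableau22_mem_span _
  · rintro _ (rfl | rfl)
    · exact hmem
    · exact (spechtSubrep 4 shape22).apply_mem_toSubmodule _ hmem

/-- The quadratic form attached to a row function: products of entries in a common row get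
weight `2`, the other products of distinct entries get weight `-1`. -/
noncomputable def tabloidForm (r : Fin n → ℕ) : MvPolynomial (Fin n) ℂ :=
  ∑ i, ∑ j, (if i = j then 0 else if r i = r j then 2 else -1 : ℂ) • (X i * X j)

theorem isHomogeneous_tabloidForm (r : Fin n → ℕ) : (tabloidForm r).IsHomogeneous 2 := by
  refine IsHomogeneous.sum _ _ _ fun i _ => IsHomogeneous.sum _ _ _ fun j _ => ?_
  rw [smul_eq_C_mul]
  exact ((isHomogeneous_X ℂ i).mul (isHomogeneous_X ℂ j)).C_mul _

theorem rename_tabloidForm (σ : Equiv.Perm (Fin n)) (r : Fin n → ℕ) :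
    rename σ (tabloidForm r) = tabloidForm (r ∘ (σ⁻¹ : Equiv.Perm (Fin n))) := by
  simp only [tabloidForm, map_sum, map_smul, map_mul, rename_X]
  refine Fintype.sum_equiv σ _ _ fun i => Fintype.sum_equiv σ _ _ fun j => ?_
  simp

/-- The equivariant linear map sending a row function to the `k`-th power of its form. -/
noncomputable def formPowMap (n k : ℕ) : ((Fin n → ℕ) →₀ ℂ) →ₗ[ℂ] MvPolynomial (Fin n) ℂ :=
  Finsupp.linearCombination ℂ fun r => tabloidForm r ^ k

theorem formPowMap_single (k : ℕ) (r : Fin n → ℕ) :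
    formPowMap n k (Finsupp.single r 1) = tabloidForm r ^ k := by
  rw [formPowMap, Finsupp.linearCombination_single, one_smul]

theorem formPowMap_tabloidRep (k : ℕ) (σ : Equiv.Perm (Fin n)) (v : (Fin n → ℕ) →₀ ℂ) :
    formPowMap n k (tabloidRep n σ v) = permPolyRep n σ (formPowMap n k v) := by
  refine LinearMap.congr_fun (f := formPowMap n k ∘ₗ tabloidRep n σ)
    (g := permPolyRep n σ ∘ₗ formPowMap n k) ?_ v
  refine Finsupp.lhom_ext' fun r => LinearMap.ext_ring ?_
  simp only [LinearMap.comp_apply, Finsupp.lsingle_apply, tabloidRep_single, formPowMap_single]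
  change _ = rename σ (tabloidForm r ^ k)
  rw [map_pow, rename_tabloidForm]

theorem isHomogeneous_formPowMap (k : ℕ) (v : (Fin n → ℕ) →₀ ℂ) :
    (formPowMap n k v).IsHomogeneous (2 * k) := by
  rw [formPowMap, Finsupp.linearCombination_apply]
  refine IsHomogeneous.sum _ _ _ fun r _ => ?_
  change (v r • tabloidForm r ^ k).IsHomogeneous (2 * k)
  rw [smul_eq_C_mul]
  exact ((isHomogeneous_tabloidForm r).pow k).C_mul _

/-- Exchanging the two rows does not change the form, so the four tabloids collapse in pairs: this
is the outer 2. The inner 2 counts ordered pairs of indices. -/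
theorem eval_formPowMap_polytabloid (k : ℕ) (x : Fin 4 → ℂ) :
    eval x (formPowMap 4 k (polytabloid tableau22)) =
      2 * ((2 * (2 * (x 0 * x 1 + x 2 * x 3) - (x 0 * x 2 + x 1 * x 3) -
          (x 0 * x 3 + x 1 * x 2))) ^ k -
        (2 * (2 * (x 0 * x 3 + x 1 * x 2) - (x 0 * x 2 + x 1 * x 3) -
          (x 0 * x 1 + x 2 * x 3))) ^ k) := by
  have h1 : eval x (tabloidForm ![0, 0, 1, 1]) = 2 * (2 * (x 0 * x 1 + x 2 * x 3) -
      (x 0 * x 2 + x 1 * x 3) - (x 0 * x 3 + x 1 * x 2)) := by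
    simp [tabloidForm, Fin.sum_univ_four]; ring
  have h2 : eval x (tabloidForm ![1, 1, 0, 0]) = 2 * (2 * (x 0 * x 1 + x 2 * x 3) -
      (x 0 * x 2 + x 1 * x 3) - (x 0 * x 3 + x 1 * x 2)) := by
    simp [tabloidForm, Fin.sum_univ_four]; ring
  have h3 : eval x (tabloidForm ![0, 1, 1, 0]) = 2 * (2 * (x 0 * x 3 + x 1 * x 2) -
      (x 0 * x 2 + x 1 * x 3) - (x 0 * x 1 + x 2 * x 3)) := by
    simp [tabloidForm, Fin.sum_univ_four]; ring
  have h4 : eval x (tabloidForm ![1, 0, 0, 1]) = 2 * (2 * (x 0 * x 3 + x 1 * x 2) -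
      (x 0 * x 2 + x 1 * x 3) - (x 0 * x 1 + x 2 * x 3)) := by
    simp [tabloidForm, Fin.sum_univ_four]; ring
  rw [polytabloid_tableau22]
  simp only [map_add, map_sub, formPowMap_single, map_pow, h1, h2, h3, h4]
  ring

theorem eval_formPowMap_tabloidRep_swap (k : ℕ) (x : Fin 4 → ℂ) :
    eval x (formPowMap 4 k (tabloidRep 4 (Equiv.swap 1 2) (polytabloid tableau22))) =
      2 * ((2 * (2 * (x 0 * x 2 + x 1 * x 3) - (x 0 * x 1 + x 2 * x 3) -
          (x 0 * x 3 + x 1 * x 2))) ^ k -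
        (2 * (2 * (x 0 * x 3 + x 1 * x 2) - (x 0 * x 2 + x 1 * x 3) -
          (x 0 * x 1 + x 2 * x 3))) ^ k) := by
  rw [formPowMap_tabloidRep]
  change eval x (rename (Equiv.swap 1 2 : Equiv.Perm (Fin 4)) _) = _
  rw [eval_rename, eval_formPowMap_polytabloid]
  simp only [Function.comp_apply, show Equiv.swap (1 : Fin 4) 2 0 = 0 by decide,
    show Equiv.swap (1 : Fin 4) 2 1 = 2 by decide, show Equiv.swap (1 : Fin 4) 2 2 = 1 by decide,
    show Equiv.swap (1 : Fin 4) 2 3 = 3 by decide]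
  ring

theorem linearIndependent_formPowMap {k : ℕ} (hk : k = 1 ∨ k = 2) :
    LinearIndependent ℂ ![formPowMap 4 k (polytabloid tableau22),
      formPowMap 4 k (tabloidRep 4 (Equiv.swap 1 2) (polytabloid tableau22))] := by
  rw [LinearIndependent.pair_iff]
  intro a b hab
  have h (x : Fin 4 → ℂ) := congrArg (eval x) hab
  simp only [map_add, smul_eval, eval_formPowMap_polytabloid, eval_formPowMap_tabloidRep_swap,
    map_zero] at h
  -- At this point the three forms are 4, -2, -2, so only the coefficient `a` survives; the next
  -- point isolates `b`.
  have h1 := h ![1, 1, 0, 0]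
  have h2 := h ![1, 0, 1, 0]
  rcases hk with rfl | rfl <;> simp only [Matrix.cons_val] at h1 h2 <;>
    norm_num at h1 h2 <;> exact ⟨h1, h2⟩

theorem isBasisOfS22_formPowMap {k : ℕ} (hk : k = 1 ∨ k = 2) :
    IsBasisOfS22 (2 * k) (formPowMap 4 k (polytabloid tableau22))
      (formPowMap 4 k (tabloidRep 4 (Equiv.swap 1 2) (polytabloid tableau22))) where
  homogeneous_fst := isHomogeneous_formPowMap k _
  homogeneous_snd := isHomogeneous_formPowMap k _
  linearIndependent := linearIndependent_formPowMap hk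
  isSpecht := by
    obtain ⟨V, hV, hE⟩ := (spechtSubrep 4 shape22).exists_equiv_map (formPowMap 4 k)
      (formPowMap_tabloidRep k) fun v hv hzero => by
        rw [spechtSubrep_shape22_eq_span, Submodule.mem_span_pair] at hv
        obtain ⟨a, b, rfl⟩ := hv
        rw [map_add, map_smul, map_smul] at hzero
        obtain ⟨rfl, rfl⟩ :=
          LinearIndependent.pair_iff.mp (linearIndependent_formPowMap hk) a b hzero
        rw [zero_smul, zero_smul, add_zero]
    refine ⟨V, ?_, hE⟩
    rw [hV, spechtSubrep_shape22_eq_span, Submodule.map_span, Set.image_pair]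

end Specht

/-! ### Common zeros and existence -/

theorem MvPolynomial.isHomogeneous_psum (n d : ℕ) : (psum (Fin n) ℂ d).IsHomogeneous d :=
  IsHomogeneous.sum _ _ _ fun i _ => isHomogeneous_X_pow i d

/-- Compare absolute values: 3^d ≥ 9 > 3. For d = 1 the sum is zero. -/
theorem three_add_neg_three_pow_ne_zero {d : ℕ} (hd : 2 ≤ d) : (3 + (-3) ^ d : ℂ) ≠ 0 := by
  intro h
  have h1 : ((-3) ^ d : ℂ) = -3 := by linear_combination h
  have h2 := congrArg norm h1
  rw [norm_pow, norm_neg, RCLike.norm_ofNat] at h2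
  have h3 : (3 : ℝ) ^ 2 ≤ 3 ^ d := pow_le_pow_right₀ (by norm_num) hd
  norm_num [h2] at h3

theorem eq_zero_of_three_mul_add_eq_zero {d : ℕ} (hd : 2 ≤ d) {t s : ℂ} (h1 : 3 * t + s = 0)
    (h2 : 3 * t ^ d + s ^ d = 0) : t = 0 ∧ s = 0 := by
  obtain rfl : s = -3 * t := by linear_combination h1
  have h : (3 + (-3) ^ d) * t ^ d = 0 := by rw [mul_pow] at h2; linear_combination h2
  have ht : t = 0 := eq_zero_of_pow_eq_zero
    ((mul_eq_zero.mp h).resolve_left (three_add_neg_three_pow_ne_zero hd))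
  simp [ht]

/-- Each of the three perfect matchings of the indices contains a pair of equal coordinates. Three
such edges form a star or a triangle, so at least three coordinates agree, and the two power sums
then force them all to vanish. -/
theorem eq_zero_of_prod_sub_eq_zero {d : ℕ} (hd : 2 ≤ d) {x : Fin 4 → ℂ}
    (h1 : (x 0 - x 3) * (x 1 - x 2) = 0) (h2 : (x 0 - x 2) * (x 1 - x 3) = 0)
    (h3 : (x 0 - x 1) * (x 2 - x 3) = 0) (hp : eval x (psum (Fin 4) ℂ 1) = 0)
    (hpd : eval x (psum (Fin 4) ℂ d) = 0) : x = 0 := by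
  simp only [psum, map_add, map_pow, eval_X, Fin.sum_univ_four, pow_one] at hp hpd
  suffices x 0 = 0 ∧ x 1 = 0 ∧ x 2 = 0 ∧ x 3 = 0 by
    funext i
    fin_cases i <;> simp [this]
  have key {a b c e : ℂ} (hab : a = b) (hac : a = c) (hs : a + b + c + e = 0)
      (hsd : a ^ d + b ^ d + c ^ d + e ^ d = 0) : a = 0 ∧ b = 0 ∧ c = 0 ∧ e = 0 := by
    subst hab hac
    obtain ⟨ha, he⟩ := eq_zero_of_three_mul_add_eq_zero hd (t := a) (s := e)
      (by linear_combination hs) (by linear_combination hsd)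
    exact ⟨ha, ha, ha, he⟩
  simp only [mul_eq_zero, sub_eq_zero] at h1 h2 h3
  have h012 (ha : x 0 = x 1) (hb : x 0 = x 2) := key ha hb hp hpd
  have h013 (ha : x 0 = x 1) (hb : x 0 = x 3) := key (e := x 2) ha hb
    (by linear_combination hp) (by linear_combination hpd)
  have h023 (ha : x 0 = x 2) (hb : x 0 = x 3) := key (e := x 1) ha hb
    (by linear_combination hp) (by linear_combination hpd)
  have h123 (ha : x 1 = x 2) (hb : x 1 = x 3) := key (e := x 0) ha hb
    (by linear_combination hp) (by linear_combination hpd)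
  grind

/-- Here a and b equal c up to sign, so a+b+c is an odd multiple of c. The weights 2 and -1 in
`tabloidForm` were chosen to make the three forms sum to zero. -/
theorem eq_zero_of_pow_eq_pow_of_add_eq_zero {k : ℕ} (hk : k = 1 ∨ k = 2) {a b c : ℂ}
    (hac : a ^ k = c ^ k) (hbc : b ^ k = c ^ k) (h : a + b + c = 0) : a = 0 ∧ b = 0 ∧ c = 0 := by
  rcases hk with rfl | rfl
  · simp only [pow_one] at hac hbc
    subst hac hbc
    have : b = 0 := by linear_combination h / 3
    simp [this]
  · have hc : c = 0 := by
      rcases sq_eq_sq_iff_eq_or_eq_neg.mp hac with rfl | rfl <;>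
        rcases sq_eq_sq_iff_eq_or_eq_neg.mp hbc with rfl | rfl
      · linear_combination h / 3
      · linear_combination h
      · linear_combination h
      · linear_combination -h
    subst hc
    simpa using And.intro hac hbc

theorem eq_zero_of_eval_formPowMap_eq_zero {k d : ℕ} (hk : k = 1 ∨ k = 2) (hd : 2 ≤ d)
    {x : Fin 4 → ℂ} (h1 : eval x (formPowMap 4 k (polytabloid tableau22)) = 0)
    (h2 : eval x (formPowMap 4 k (tabloidRep 4 (Equiv.swap 1 2) (polytabloid tableau22))) = 0)
    (hp : eval x (psum (Fin 4) ℂ 1) = 0) (hpd : eval x (psum (Fin 4) ℂ d) = 0) : x = 0 := by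
  rw [eval_formPowMap_polytabloid, mul_eq_zero, sub_eq_zero] at h1
  rw [eval_formPowMap_tabloidRep_swap, mul_eq_zero, sub_eq_zero] at h2
  obtain ⟨ha, hb, hc⟩ := eq_zero_of_pow_eq_pow_of_add_eq_zero hk
    (h1.resolve_left two_ne_zero) (h2.resolve_left two_ne_zero) (by ring)
  refine eq_zero_of_prod_sub_eq_zero hd ?_ ?_ ?_ hp hpd
  -- The difference of two of the forms is 6 times a product of two coordinate differences.
  · linear_combination ha / 6 - hb / 6
  · linear_combination ha / 6 - hc / 6
  · linear_combination hb / 6 - hc / 6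

theorem exists_isRegularSequenceOfType {k c d : ℕ} (hk : k = 1 ∨ k = 2) (hc : 0 < c) (hd : 0 < d)
    (hcd : ¬ (c = 1 ∧ d = 1)) : ∃ g₁ g₂ f₁ f₂ : MvPolynomial (Fin 4) ℂ,
      IsRegularSequenceOfType (2 * k) c d g₁ g₂ f₁ f₂ := by
  have hbasis := isBasisOfS22_formPowMap hk
  obtain ⟨f₁, f₂, hf₁, hf₂, hs₁, hs₂, hf⟩ : ∃ f₁ f₂ : MvPolynomial (Fin 4) ℂ,
      f₁.IsHomogeneous c ∧ f₂.IsHomogeneous d ∧ f₁.IsSymmetric ∧ f₂.IsSymmetric ∧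
      ∀ x : Fin 4 → ℂ, eval x f₁ = 0 → eval x f₂ = 0 →
        ∃ m, 2 ≤ m ∧ eval x (psum (Fin 4) ℂ 1) = 0 ∧ eval x (psum (Fin 4) ℂ m) = 0 := by
    have hpow (m : ℕ) : (psum (Fin 4) ℂ 1 ^ m).IsHomogeneous m := by
      simpa using (isHomogeneous_psum 4 1).pow m
    have hpows (m : ℕ) : (psum (Fin 4) ℂ 1 ^ m).IsSymmetric := fun e => by
      rw [map_pow, rename_psum]
    -- One degree is at least 2 and takes the power sum; the other takes a power of p₁, which has
    -- the zeros of p₁ in any positive degree.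
    rcases Nat.lt_or_ge d 2 with hd2 | hd2
    · refine ⟨psum (Fin 4) ℂ c, psum (Fin 4) ℂ 1 ^ d, isHomogeneous_psum 4 c, hpow d,
        psum_isSymmetric _ _ c, hpows d, fun x h1 h2 => ⟨c, by omega, ?_, h1⟩⟩
      exact eq_zero_of_pow_eq_zero (by rwa [map_pow] at h2)
    · refine ⟨psum (Fin 4) ℂ 1 ^ c, psum (Fin 4) ℂ d, hpow c, isHomogeneous_psum 4 d, hpows c,
        psum_isSymmetric _ _ d, fun x h1 h2 => ⟨d, hd2, ?_, h2⟩⟩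
      exact eq_zero_of_pow_eq_zero (by rwa [map_pow] at h1)
  refine ⟨_, _, f₁, f₂, hbasis, hs₁, hs₂, hf₁, hf₂, fun i => ?_, ?_⟩
  · fin_cases i
    · exact ⟨_, hbasis.homogeneous_fst⟩
    · exact ⟨_, hbasis.homogeneous_snd⟩
    · exact ⟨_, hf₁⟩
    · exact ⟨_, hf₂⟩
  · refine Set.Subset.antisymm (fun x hx => ?_) ?_
    · obtain ⟨m, hm, hp, hpm⟩ := hf x (hx 2) (hx 3)
      exact eq_zero_of_eval_formPowMap_eq_zero hk hm (hx 0) (hx 1) hp hpm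
    · rintro _ rfl i
      fin_cases i
      · exact hbasis.homogeneous_fst.eval_zero_of_pos (by omega)
      · exact hbasis.homogeneous_snd.eval_zero_of_pos (by omega)
      · exact hf₁.eval_zero_of_pos hc
      · exact hf₂.eval_zero_of_pos hd

theorem proposition4 :
    (∀ a c d : ℕ, (a = 2 ∨ a = 4) → 0 < c → 0 < d →
      ((∃ g₁ g₂ f₁ f₂ : MvPolynomial (Fin 4) ℂ, IsRegularSequenceOfType a c d g₁ g₂ f₁ f₂) ↔
        ¬ (c = 1 ∧ d = 1))) ∧
    (∀ c d : ℕ, 0 < c → 0 < d →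
      ¬ ∃ g₁ g₂ f₁ f₂ : MvPolynomial (Fin 4) ℂ, IsRegularSequenceOfType 3 c d g₁ g₂ f₁ f₂) ∧
    (∀ g₁ g₂ : MvPolynomial (Fin 4) ℂ, IsBasisOfS22 3 g₁ g₂ →
      ∃ p : MvPolynomial (Fin 4) ℂ, 0 < p.totalDegree ∧ p ∣ g₁ ∧ p ∣ g₂) := by
  refine ⟨fun a c d ha hc hd => ⟨?_, fun hcd => ?_⟩, ?_, fun g₁ g₂ hg => ?_⟩
  · rintro ⟨g₁, g₂, f₁, f₂, h⟩ ⟨rfl, rfl⟩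
    exact not_isRegularSequenceOfType_one_one h
  · rcases ha with rfl | rfl
    · exact exists_isRegularSequenceOfType (Or.inl rfl) hc hd hcd
    · exact exists_isRegularSequenceOfType (Or.inr rfl) hc hd hcd
  · rintro c d hc hd ⟨g₁, g₂, f₁, f₂, h⟩
    exact not_isRegularSequenceOfType_three hc hd h
  · refine ⟨psum (Fin 4) ℂ 1, ?_, hg.psum_dvd_of_degree_three (Submodule.subset_span (by simp)),
      hg.psum_dvd_of_degree_three (Submodule.subset_span (by simp))⟩
    have hne : psum (Fin 4) ℂ 1 ≠ 0 := fun h => by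
      simpa [psum] using congrArg (eval 1) h
    rw [(isHomogeneous_psum 4 1).totalDegree hne]
    exact one_pos
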